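/- \textbf{Notation.} Let $\mathbb H$ be the quaternions, $\mathbb S=\{I\in\mathbb H: I^2=-1\}$, $\mathbb C_I=\mathbb R+\mathbb R I$, $\mathbb H_s^n=\bigcup_{I\in\mathbb S}\mathbb C_I^n\subset\mathbb H^n$, and for $z=x+yi\in\mathbb C^n$ write $z^I=x+yI\in\mathbb C_I^n$. A set $U\subset\mathbb H_s^n$ is \emph{slice-open} if $U\cap\mathbb C_I^n$ is open in $\mathbb C_I^n$ for every $I\in\mathbb S$; a \emph{slice-domain} is a slice-open set that is connected in this topology. Let $\mathscr P(\mathbb C^n)$ be the set of continuous $\gamma:[0,1]\to\mathbb C^n$ with $\gamma(0)\in\mathbb R^n$; put $\mathbb S(\Omega,\gamma)=\{I\in\mathbb S:\gamma^I\subset\Omega\}$ and $\mathscr P(\mathbb C^n,\Omega)=\{\gamma\in\mathscr P(\mathbb C^n):\mathbb S(\Omega,\gamma)\neq\emptyset\}$. A set $\Omega\subset\mathbb H_s^n$ is \emph{real-path-connected} if every $q\in\Omega$ equals $\gamma^I(1)$ for some $\gamma\in\mathscr P(\mathbb C^n,\Omega)$, $I\in\mathbb S(\Omega,\gamma)$.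 $\Omega_2$ is \emph{$\Omega_1$-stem-preserving} if $|\mathbb S(\Omega_2,\gamma)|\ge2$ for all $\gamma\in\mathscr P(\mathbb C^n,\Omega_1)$, and $|\mathbb S(\Omega_2,\alpha)\cap\mathbb S(\Omega_2,\beta)|\neq1$ for all $\alpha,\beta\in\mathscr P(\mathbb C^n,\Omega_1)$ with $\alpha(1)=\beta(1)$. A function $f:\Omega\to\mathbb H$ on a slice-open set is \emph{slice regular} if for each $I\in\mathbb S$ the restriction $f|_{\Omega\cap\mathbb C_I^n}$ is real differentiable and satisfies $\frac12\left(\frac{\partial}{\partial x_\ell}+I\frac{\partial}{\partial y_\ell}\right)f(x+yI)=0$ for $\ell=1,\dots,n$. A function $f:\Omega\to\mathbb H$ is \emph{path-slice} if there is $F:\mathscr P(\mathbb C^n,\Omega)\to\mathbb H^{2\times1}$ (a stem function) with $f(\gamma^I(1))=(1,I)F(\gamma)$ for all $\gamma\in\mathscr P(\mathbb C^n,\Omega)$ and $I\in\mathbb S(\Omega,\gamma)$. Let $\Omega_1$ be real-path-connected, $\Omega_2$ be $\Omega_1$-stem-preserving, and $f:\Omega_2\to\mathbb H$ be path-slice with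 a stem function $F$. For $q\in\mathbb H_s^n$ let $\mathfrak I(q)=0$ if $q\in\mathbb R^n$, and otherwise let $\mathfrak I(q)\in\mathbb S$ be the normalized imaginary part of the first non-real component of $q$. For $q\in\Omega_1$ set $\mathscr F(q)=(f(q),0)^T$ if $q\in\mathbb R^n$, and otherwise $\mathscr F(q)=F(\gamma)$ for any $\gamma\in\mathscr P(\mathbb C^n,\Omega_1)$ with $\gamma^{\mathfrak I(q)}\subset\Omega_1$ and $\gamma^{\mathfrak I(q)}(1)=q$ (this does not depend on $F$ or $\gamma$). With $\mathscr F=(\mathscr F^1,\mathscr F^2)^T$, define on $\Omega_1$ the conjugation $f^c_{\Omega_1}=\overline{\mathscr F^1}+\mathfrak I\,\overline{\mathscr F^2}$ and the symmetrization $f^s_{\Omega_1}=f^c_{\Omega_1}*f:=f^c_{\Omega_1}\mathscr F^1+\mathfrak I f^c_{\Omega_1}\mathscr F^2$, and let $\mathcal Z(f^s_{\Omega_1})=\{q\in\Omega_1:f^s_{\Omega_1}(q)=0\}$. A subset $A$ of a slice-domain $\Omega$ is \emph{path-slice analytic} if either $A=\Omega$, or for each $\gamma\in\mathscr P(\mathbb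 C^n,\Omega)$ there are $r>0$, radii $r_{[I]}\in(0,r]$ for $I\in\mathbb S(\Omega,\gamma)$, and an analytic subset $E\neq B_{\mathbb C^n}(\gamma(1),r)$ of the ball $B_{\mathbb C^n}(\gamma(1),r)$ (i.e. near each point of the ball, $E$ is the common zero set of finitely many holomorphic functions) such that, for all $I\in\mathbb S(\Omega,\gamma)$, $$A\cap\{q\in\mathbb C_I^n:|q-\gamma^I(1)|<r_{[I]}\}\subseteq E^I:=\{z^I:z\in E\}.$$ \textbf{Statement.} Let $\Omega_1\subset\mathbb H_s^n$ be a real-path-connected slice-domain, let $\Omega_2\subset\mathbb H_s^n$ be slice-open and $\Omega_1$-stem-preserving, and let $f$ be slice regular on $\Omega_2$. Then $f$ is path-slice (so that $f^s_{\Omega_1}$ is defined), and $\mathcal Z(f^s_{\Omega_1})$ is path-slice analytic in $\Omega_1$. -/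

import Mathlib

open scoped Quaternion

noncomputable section

namespace SliceAnalysis

/-- The sphere `𝕊` of quaternionic imaginary units. -/
abbrev ImUnit : Type := {I : ℍ[ℝ] // I ^ 2 = -1}

/-- `ℂⁿ` with its Euclidean norm. -/
abbrev Cn (n : ℕ) : Type := EuclideanSpace ℂ (Fin n)

/-- The map `x + y i ↦ x + y I` from `ℂⁿ` to `ℍⁿ`; the range of it is `ℂ_Iⁿ = (ℝ + ℝ I)ⁿ`. -/
def embedVec {n : ℕ} (I : ImUnit) (z : Cn n) : EuclideanSpace ℍ[ℝ] (Fin n) :=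
  WithLp.toLp 2 fun l => ((z l).re : ℍ[ℝ]) + ((z l).im : ℍ[ℝ]) * (I : ℍ[ℝ])

/-- The weak slice cone `ℍ_sⁿ = ⋃_{I ∈ 𝕊} ℂ_Iⁿ ⊆ ℍⁿ`. (A plain `def`, so that it does not inherit
the Euclidean topology: its topology is the slice topology below.) -/
def SliceCone (n : ℕ) : Type :=
  {q : EuclideanSpace ℍ[ℝ] (Fin n) // ∃ I : ImUnit, q ∈ Set.range (embedVec (n := n) I)}

variable {n : ℕ}

/-- The underlying point of `ℍⁿ`. -/
def SliceCone.toVec (q : SliceCone n) : EuclideanSpace ℍ[ℝ] (Fin n) := q.1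

/-- `Ψ_i^I : ℂⁿ → ℂ_Iⁿ ⊆ ℍ_sⁿ`, `z ↦ z^I`. -/
def psi (I : ImUnit) (z : Cn n) : SliceCone n := ⟨embedVec I z, I, z, rfl⟩

/-- `Ω` seen in the slice `ℂ_Iⁿ`, in the coordinate `z ∈ ℂⁿ` of `z^I ∈ ℂ_Iⁿ`. -/
def sliceOf (I : ImUnit) (Ω : Set (SliceCone n)) : Set (Cn n) := psi I ⁻¹' Ω

/-- The slice topology: `U` is open iff each `U ∩ ℂ_Iⁿ` is open in `ℂ_Iⁿ`
(which is identified with `ℂⁿ` through the isometry `z ↦ z^I`). -/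
instance sliceTopology : TopologicalSpace (SliceCone n) where
  IsOpen U := ∀ I : ImUnit, IsOpen (sliceOf I U)
  isOpen_univ := fun _ => isOpen_univ
  isOpen_inter := fun _ _ hs ht I => (hs I).inter (ht I)
  isOpen_sUnion := fun S hS I => by
    have h : sliceOf I (⋃₀ S) = ⋃ U ∈ S, sliceOf I U := by
      simp [sliceOf, Set.preimage_sUnion]
    rw [h]
    exact isOpen_biUnion fun U hU => hS U hU I

/-- A slice-domain: a connected open set of the slice topology (the empty set is not excluded). -/
def IsSliceDomain (Ω : Set (SliceCone n)) : Prop := IsOpen Ω ∧ IsPreconnected Ω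

/-- The open Euclidean ball `B_I(p, r)` of `ℂ_Iⁿ`. -/
def sliceBall (I : ImUnit) (p : SliceCone n) (r : ℝ) : Set (SliceCone n) :=
  {q | q ∈ Set.range (psi (n := n) I) ∧ dist q.toVec p.toVec < r}

/-- `𝒫(ℂⁿ)`: continuous paths `[0, 1] → ℂⁿ` starting at a point of `ℝⁿ`. -/
abbrev RealPath (n : ℕ) : Type :=
  {γ : C(unitInterval, Cn n) // ∀ l, (γ 0 l).im = 0}

/-- The end point `γ(1)`. -/
def endPt (γ : RealPath n) : Cn n := γ.1 1

/-- `𝕊(Ω, γ)`: the units `I` with `γ^I ⊆ Ω`. -/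
def unitsOf (Ω : Set (SliceCone n)) (γ : RealPath n) : Set ImUnit :=
  {I | ∀ t, psi I (γ.1 t) ∈ Ω}

/-- `𝒫(ℂⁿ, Ω)`: the paths `γ ∈ 𝒫(ℂⁿ)` with `γ^I ⊆ Ω` for some `I ∈ 𝕊`. -/
def pathsIn (Ω : Set (SliceCone n)) : Set (RealPath n) := {γ | (unitsOf Ω γ).Nonempty}

/-- Every point of `Ω` is `γ^I(1)` for some `γ ∈ 𝒫(ℂⁿ, Ω)` and `I ∈ 𝕊(Ω, γ)`. -/
def IsRealPathConnected (Ω : Set (SliceCone n)) : Prop :=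
  ∀ q ∈ Ω, ∃ γ ∈ pathsIn Ω, ∃ I ∈ unitsOf Ω γ, psi I (endPt γ) = q

/-- `Ω₂` is `Ω₁`-stem-preserving. -/
def IsStemPreserving (Ω₁ Ω₂ : Set (SliceCone n)) : Prop :=
  (∀ γ ∈ pathsIn Ω₁, 2 ≤ (unitsOf Ω₂ γ).encard) ∧
  (∀ α ∈ pathsIn Ω₁, ∀ β ∈ pathsIn Ω₁, endPt α = endPt β →
    (unitsOf Ω₂ α ∩ unitsOf Ω₂ β).encard ≠ 1)

/-- `F` is a path-slice stem function of `f : Ω → ℍ`: `f(γ^I(1)) = (1, I) F(γ)`.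
Only the values of `f` on `Ω` and of `F` on `𝒫(ℂⁿ, Ω)` matter. -/
def IsStemFunction (Ω : Set (SliceCone n)) (f : SliceCone n → ℍ[ℝ])
    (F : RealPath n → ℍ[ℝ] × ℍ[ℝ]) : Prop :=
  ∀ γ ∈ pathsIn Ω, ∀ I ∈ unitsOf Ω γ, f (psi I (endPt γ)) = (F γ).1 + (I : ℍ[ℝ]) * (F γ).2

/-- `f : Ω → ℍ` is path-slice. -/
def IsPathSlice (Ω : Set (SliceCone n)) (f : SliceCone n → ℍ[ℝ]) : Prop :=
  ∃ F, IsStemFunction Ω f F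

/-- `f : Ω → ℍ`, with `Ω` slice-open, is (weakly) slice regular: on each `Ω ∩ ℂ_Iⁿ` it is real
differentiable and `½ (∂/∂x_l + I ∂/∂y_l) f(x + y I) = 0` for all `l`. -/
def IsSliceRegular (Ω : Set (SliceCone n)) (f : SliceCone n → ℍ[ℝ]) : Prop :=
  ∀ I : ImUnit, ∀ z ∈ sliceOf I Ω,
    DifferentiableAt ℝ (fun w : Cn n => f (psi I w)) z ∧
    ∀ l : Fin n,
      (1 / 2 : ℝ) •
        (fderiv ℝ (fun w : Cn n => f (psi I w)) z (EuclideanSpace.single l 1) +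
          (I : ℍ[ℝ]) *
            fderiv ℝ (fun w : Cn n => f (psi I w)) z (EuclideanSpace.single l Complex.I)) = 0

/-- `q ∈ ℝⁿ`. -/
def IsRealPt (q : SliceCone n) : Prop := ∀ l, (q.toVec l).im = 0

open Classical in
/-- `ℑ(q)`: `0` on `ℝⁿ`, and otherwise the normalized imaginary part of the first non-real
component of `q`. -/
def frakI (q : SliceCone n) : ℍ[ℝ] :=
  if h : ∃ l, (q.toVec l).im ≠ 0 then
    (‖(q.toVec (Fin.find _ h)).im‖⁻¹ : ℝ) • (q.toVec (Fin.find _ h)).im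
  else 0

open Classical in
/-- A path-slice stem function of a path-slice function `f : Ω₂ → ℍ`. When `Ω₂` is
`Ω₁`-stem-preserving, all of these have the same restriction `F_{Ω₁}^f` to `𝒫(ℂⁿ, Ω₁)`. -/
def stemFun (Ω₂ : Set (SliceCone n)) (f : SliceCone n → ℍ[ℝ]) : RealPath n → ℍ[ℝ] × ℍ[ℝ] :=
  if h : IsPathSlice Ω₂ f then h.choose else 0

open Classical in
/-- `ℱ_{Ω₁}^f : Ω₁ → ℍ²`: at a real point it is `(f(q), 0)`; at another point it is `F_{Ω₁}^f(γ)`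
for any `γ ∈ 𝒫(ℂⁿ, Ω₁)` with `γ^{ℑ(q)} ⊆ Ω₁` and `γ^{ℑ(q)}(1) = q`. -/
def scrF (Ω₁ Ω₂ : Set (SliceCone n)) (f : SliceCone n → ℍ[ℝ]) (q : SliceCone n) :
    ℍ[ℝ] × ℍ[ℝ] :=
  if IsRealPt q then (f q, 0)
  else if h : ∃ γ : RealPath n, ∃ I ∈ unitsOf Ω₁ γ,
      (I : ℍ[ℝ]) = frakI q ∧ psi I (endPt γ) = q then
    stemFun Ω₂ f h.choose
  else 0

/-- The `*`-product `f * g = (f, ℑ f) ℱ_{Ω₁}^g` of `f : Ω₁ → ℍ` and `g : Ω₂ → ℍ`. -/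
def starProd (Ω₁ Ω₂ : Set (SliceCone n)) (f g : SliceCone n → ℍ[ℝ]) (q : SliceCone n) : ℍ[ℝ] :=
  f q * (scrF Ω₁ Ω₂ g q).1 + frakI q * f q * (scrF Ω₁ Ω₂ g q).2

/-- The `Ω₁`-slice conjugation `f^c_{Ω₁}` of `f : Ω₂ → ℍ`. -/
def sliceConj (Ω₁ Ω₂ : Set (SliceCone n)) (f : SliceCone n → ℍ[ℝ]) (q : SliceCone n) : ℍ[ℝ] :=
  star (scrF Ω₁ Ω₂ f q).1 + frakI q * star (scrF Ω₁ Ω₂ f q).2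

/-- The symmetrization `f^s_{Ω₁} = f^c_{Ω₁} * f` of `f : Ω₂ → ℍ` on `Ω₁`. -/
def symmetrization (Ω₁ Ω₂ : Set (SliceCone n)) (f : SliceCone n → ℍ[ℝ]) : SliceCone n → ℍ[ℝ] :=
  starProd Ω₁ Ω₂ (sliceConj Ω₁ Ω₂ f) f

/-- The zero set `𝒵(g)` of `g : Ω → ℍ`. -/
def zeroSet (Ω : Set (SliceCone n)) (g : SliceCone n → ℍ[ℝ]) : Set (SliceCone n) :=
  {q | q ∈ Ω ∧ g q = 0}

/-- `E` is an analytic subset of the open set `B ⊆ ℂⁿ`: near every point of `B` it is the set of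
common zeros of finitely many holomorphic functions. -/
def IsAnalyticSubset (B E : Set (Cn n)) : Prop :=
  E ⊆ B ∧ ∀ p ∈ B, ∃ U : Set (Cn n), IsOpen U ∧ p ∈ U ∧ U ⊆ B ∧
    ∃ (k : ℕ) (g : Fin k → Cn n → ℂ), (∀ j, DifferentiableOn ℂ (g j) U) ∧
      E ∩ U = {z | z ∈ U ∧ ∀ j, g j z = 0}

/-- `A ⊆ Ω` is path-slice analytic in `Ω`. -/
def IsPathSliceAnalytic (Ω A : Set (SliceCone n)) : Prop :=
  A ⊆ Ω ∧ (A = Ω ∨ ∀ γ ∈ pathsIn Ω,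
    ∃ r : ℝ, 0 < r ∧
    ∃ ρ : ImUnit → ℝ, (∀ I ∈ unitsOf Ω γ, 0 < ρ I ∧ ρ I ≤ r) ∧
    ∃ E : Set (Cn n), IsAnalyticSubset (Metric.ball (endPt γ) r) E ∧
      E ≠ Metric.ball (endPt γ) r ∧
      ∀ I ∈ unitsOf Ω γ, A ∩ sliceBall I (psi I (endPt γ)) (ρ I) ⊆ psi I '' E)

end SliceAnalysis

end

open SliceAnalysis

/-!
Fix a slice regular `f : Ω₂ → ℍ`. In the slice of a unit `I` the function `z ↦ f(z^I)` is
holomorphic for the complex structure on `ℍ` given by left multiplication by `I`. For two units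
`I ≠ J` the equations `a + I b = f(z^I)`, `a + J b = f(z^J)` define a pair `(a, b)` which satisfies
the Cauchy-Riemann equations (`IsSliceRegular.holStemAt`): `a + i b` is a holomorphic function with
values in `ℍ ⊗ ℂ`, and `(a, b) = (f, 0)` on `ℝⁿ`.

A holomorphic function that vanishes on a neighbourhood in `ℝⁿ` of the starting point of a path
vanishes near the whole path (`SliceHolAt.eventually_eq_zero`). Applied to `f(z^K) - (a + K b)`,
this says that `f` is path-slice, with stem `F(γ) = (a, b)(γ(1))` for any two units that carry `γ`
into `Ω₂`.

The symmetrization at `γ^I(1)`, with `γ^I ⊆ Ω₁`, is `|a|² - |b|² + 2 I ⟨a, b⟩`, where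
`(a, b) = F(γ)`. So it vanishes iff the complex number `|a|² - |b|² + 2 i ⟨a, b⟩`, the sum of the
squares of the four coordinates of `a + i b`, vanishes (`symmetrization_eq_zero_iff`). This needs
that `F(γ)` does not depend on the path chosen in the definition, which follows from running
through one path and backwards through the other (`IsStemFunction.congr_path`).

Near `γ(1)` the stem is given by one holomorphic pair `(a, b)`, whatever the slice, so the zeros of
the symmetrization near each `γ^I(1)` come from the zero set `E` of one holomorphic function. If
`E` is a whole ball, continuation back along `γ` gives `|f|² = 0` on `ℝⁿ` near `γ(0)`. This
vanishing near the real starting point then holds for every path in `Ω₁`, because `Ω₁` is connected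
(`IsSliceDomain.forall_start`), so every stem is zero and the zero set is all of `Ω₁`.
-/

namespace SliceAnalysis

open Filter Topology

/-! ### The identity principle along paths in `ℂⁿ` -/

section IdentityPrinciple

variable {V : Type*} [NormedAddCommGroup V] [NormedSpace ℂ V]

theorem convex_preimage_complex_line (q v p : V) (r : ℝ) :
    Convex ℝ ((fun t : ℂ => q + t • v) ⁻¹' Metric.ball p r) :=
  ((convex_ball p r).translate_preimage_right q).linear_preimage
    ((LinearMap.toSpanSingleton ℂ V v).restrictScalars ℝ)

/-- On a ball, vanishing of a holomorphic function near one point spreads to the whole ball. Only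
the one-variable identity theorem is needed, applied on the complex line through two points. -/
theorem eq_zero_on_ball_of_eventually {h : V → ℂ} {p q : V} {r : ℝ}
    (hd : DifferentiableOn ℂ h (Metric.ball p r)) (hq : q ∈ Metric.ball p r)
    (h0 : ∀ᶠ w in 𝓝 q, h w = 0) : ∀ z ∈ Metric.ball p r, h z = 0 := by
  intro z hz
  let L : ℂ → V := fun t => q + t • (z - q)
  have hL : Differentiable ℂ L := by fun_prop
  have hconv : Convex ℝ (L ⁻¹' Metric.ball p r) := convex_preimage_complex_line _ _ _ _
  have hopen : IsOpen (L ⁻¹' Metric.ball p r) := Metric.isOpen_ball.preimage hL.continuous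
  have han : AnalyticOnNhd ℂ (h ∘ L) (L ⁻¹' Metric.ball p r) :=
    (hd.comp hL.differentiableOn fun t ht => ht).analyticOnNhd hopen
  have hev : (h ∘ L) =ᶠ[𝓝 0] 0 := by
    have : Tendsto L (𝓝 0) (𝓝 q) := by
      simpa [L] using hL.continuous.tendsto 0
    exact this.eventually h0
  have := han.eqOn_zero_of_preconnected_of_eventuallyEq_zero hconv.isPreconnected
    (z₀ := 0) (by simpa [L] using hq) hev (show (1 : ℂ) ∈ _ by simpa [L] using hz)
  simpa [L] using this

theorem eventually_eq_zero_along_path {h : V → ℂ} {U : Set V} (hU : IsOpen U)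
    (hd : DifferentiableOn ℂ h U) (γ : C(unitInterval, V)) (hγ : ∀ t, γ t ∈ U)
    (s : unitInterval) (h0 : ∀ᶠ w in 𝓝 (γ s), h w = 0) (t : unitInterval) :
    ∀ᶠ w in 𝓝 (γ t), h w = 0 := by
  have hopen : IsOpen {t | ∀ᶠ w in 𝓝 (γ t), h w = 0} := by
    rw [isOpen_iff_mem_nhds]
    intro t ht
    exact (γ.continuous.tendsto t).eventually (eventually_eventually_nhds.2 ht)
  have hclosed : IsClosed {t | ∀ᶠ w in 𝓝 (γ t), h w = 0} := by
    rw [← closure_subset_iff_isClosed]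
    intro t ht
    obtain ⟨r, hr, hrU⟩ := Metric.isOpen_iff.1 hU _ (hγ t)
    obtain ⟨u, hu, hu'⟩ := mem_closure_iff_nhds.1 ht _
      ((γ.continuous.tendsto t) (Metric.ball_mem_nhds _ hr))
    filter_upwards [Metric.ball_mem_nhds _ hr] with w hw
    exact eq_zero_on_ball_of_eventually (hd.mono hrU) hu hu' w hw
  have := IsClopen.eq_univ ⟨hclosed, hopen⟩ ⟨s, h0⟩
  exact (Set.ext_iff.1 this t).2 trivial

end IdentityPrinciple

variable {n : ℕ}

/-- `z ∈ ℝⁿ ⊆ ℂⁿ`. -/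
def IsRealVec (z : Cn n) : Prop := ∀ l, (z l).im = 0

/-- `ℝⁿ` is a set of uniqueness: for real `x` and `y` the function `t ↦ h (x + t y)` vanishes
for small real `t`, hence also at `t = i`. -/
theorem eventually_eq_zero_of_real {h : Cn n → ℂ} {U : Set (Cn n)} (hU : IsOpen U)
    (hd : DifferentiableOn ℂ h U) {p : Cn n} (hpU : p ∈ U) (hp : IsRealVec p)
    (h0 : ∀ᶠ w in 𝓝 p, IsRealVec w → h w = 0) : ∀ᶠ w in 𝓝 p, h w = 0 := by
  obtain ⟨r, hr, hrU⟩ := Metric.mem_nhds_iff.1 (inter_mem (hU.mem_nhds hpU) h0)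
  -- the componentwise real and imaginary parts
  let x : Cn n → Cn n := fun z => WithLp.toLp 2 fun l => ((z l).re : ℂ)
  let y : Cn n → Cn n := fun z => WithLp.toLp 2 fun l => ((z l).im : ℂ)
  have hx : Continuous x := by fun_prop
  have hxp : x p = p := by
    ext l
    exact Complex.ext (by simp [x]) (by simp [x, hp l])
  have hev : ∀ᶠ w in 𝓝 p, x w ∈ Metric.ball p r :=
    hx.continuousAt.eventually (by rw [hxp]; exact Metric.ball_mem_nhds _ hr)
  filter_upwards [hev, Metric.ball_mem_nhds p hr] with z hz hzr
  let L : ℂ → Cn n := fun t => x z + t • y z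
  have hL : Differentiable ℂ L := by fun_prop
  have hL1 : L Complex.I = z := by
    ext l
    simp only [L, x, y, PiLp.add_apply, PiLp.smul_apply, smul_eq_mul]
    rw [mul_comm]
    exact Complex.re_add_im _
  have hconv : Convex ℝ (L ⁻¹' Metric.ball p r) := convex_preimage_complex_line _ _ _ _
  have hopen : IsOpen (L ⁻¹' Metric.ball p r) := Metric.isOpen_ball.preimage hL.continuous
  have han : AnalyticOnNhd ℂ (h ∘ L) (L ⁻¹' Metric.ball p r) :=
    ((hd.mono (hrU.trans Set.inter_subset_left)).comp hL.differentiableOn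
      fun t ht => ht).analyticOnNhd hopen
  have h0mem : (0 : ℂ) ∈ L ⁻¹' Metric.ball p r := by simpa [L] using hz
  have hfreq : ∃ᶠ t in 𝓝[≠] (0 : ℂ), (h ∘ L) t = 0 := by
    have h1 : Tendsto (fun s : ℝ => (s : ℂ)) (𝓝[≠] 0) (𝓝[≠] 0) := by
      refine tendsto_nhdsWithin_iff.2 ⟨?_, ?_⟩
      · exact (Complex.continuous_ofReal.tendsto' 0 0 (by simp)).mono_left nhdsWithin_le_nhds
      · filter_upwards [self_mem_nhdsWithin] with s hs
        simpa using hs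
    refine h1.frequently (Eventually.frequently ?_)
    have h2 : ∀ᶠ s : ℝ in 𝓝 0, (s : ℂ) ∈ L ⁻¹' Metric.ball p r :=
      (Complex.continuous_ofReal.tendsto' 0 0 (by simp)).eventually (hopen.mem_nhds h0mem)
    filter_upwards [nhdsWithin_le_nhds h2] with s hs
    refine (hrU hs).2 fun l => ?_
    simp [L, x, y]
  have := han.eqOn_zero_of_preconnected_of_frequently_eq_zero hconv.isPreconnected h0mem hfreq
    (show Complex.I ∈ _ by rw [Set.mem_preimage, hL1]; exact hzr)
  simpa [hL1] using this

/-! ### Holomorphic stems -/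

/-- The pair `(A, B)`, read as the `ℍ ⊗ ℂ`-valued function `A + i B` on `ℂⁿ`, is complex
differentiable at `z`: its real derivatives satisfy the Cauchy-Riemann equations. -/
def HolStemAt (A B : Cn n → ℍ[ℝ]) (z : Cn n) : Prop :=
  ∃ A' B' : Cn n →L[ℝ] ℍ[ℝ], HasFDerivAt A A' z ∧ HasFDerivAt B B' z ∧
    ∀ v, A' (Complex.I • v) = -B' v ∧ B' (Complex.I • v) = A' v

theorem HolStemAt.differentiableAt {A B : Cn n → ℍ[ℝ]} {z : Cn n} (h : HolStemAt A B z)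
    (φ : ℍ[ℝ] →ₗ[ℝ] ℝ) :
    DifferentiableAt ℂ (fun w => (φ (A w) : ℂ) + φ (B w) * Complex.I) z := by
  obtain ⟨A', B', hA, hB, hAB⟩ := h
  let ψ : ℍ[ℝ] →L[ℝ] ℝ := LinearMap.toContinuousLinearMap φ
  have hd : HasFDerivAt (fun w => (φ (A w) : ℂ) + φ (B w) * Complex.I)
      ((Complex.ofRealCLM.comp (ψ.comp A')) +
        (ContinuousLinearMap.mul ℝ ℂ).flip Complex.I ∘L
          (Complex.ofRealCLM.comp (ψ.comp B'))) z :=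
    (Complex.ofRealCLM.hasFDerivAt.comp z (ψ.hasFDerivAt.comp z hA)).add
      (((ContinuousLinearMap.mul ℝ ℂ).flip Complex.I).hasFDerivAt.comp z
        (Complex.ofRealCLM.hasFDerivAt.comp z (ψ.hasFDerivAt.comp z hB)))
  set D := ((Complex.ofRealCLM.comp (ψ.comp A')) +
        (ContinuousLinearMap.mul ℝ ℂ).flip Complex.I ∘L
          (Complex.ofRealCLM.comp (ψ.comp B'))) with hD
  have hDI : ∀ v, D (Complex.I • v) = Complex.I • D v := by
    intro v
    simp only [hD, add_apply, ContinuousLinearMap.comp_apply,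
      ContinuousLinearMap.flip_apply, ContinuousLinearMap.mul_apply', Complex.ofRealCLM_apply,
      hAB, map_neg, smul_eq_mul]
    linear_combination (-(ψ (B' v) : ℂ)) * Complex.I_sq
  refine (differentiableAt_iff_restrictScalars ℝ hd.differentiableAt).2
    ⟨{ toFun := D, map_add' := D.map_add, map_smul' := fun c v => ?_, cont := D.cont }, ?_⟩
  · have : c • v = c.re • v + c.im • Complex.I • v := by
      conv_lhs => rw [← Complex.re_add_im c]
      rw [add_smul, mul_smul]
      rfl
    rw [this, D.map_add, D.map_smul, D.map_smul, hDI]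
    conv_rhs => rw [← Complex.re_add_im c]
    simp only [RingHom.id_apply, smul_eq_mul, Complex.real_smul]
    ring
  · rw [hd.fderiv]
    rfl

/-- The quadratic form `|a|² - |b|² + 2 i ⟨a, b⟩` of `a + i b ∈ ℍ ⊗ ℂ`, that is, the sum of
the squares of its four complex coordinates. -/
noncomputable def complexNormSq (a b : ℍ[ℝ]) : ℂ :=
  ((a.re : ℂ) + b.re * Complex.I) ^ 2 + ((a.imI : ℂ) + b.imI * Complex.I) ^ 2 +
    ((a.imJ : ℂ) + b.imJ * Complex.I) ^ 2 + ((a.imK : ℂ) + b.imK * Complex.I) ^ 2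

theorem complexNormSq_eq_zero_iff (a b : ℍ[ℝ]) :
    complexNormSq a b = 0 ↔
      a.re ^ 2 + a.imI ^ 2 + a.imJ ^ 2 + a.imK ^ 2 = b.re ^ 2 + b.imI ^ 2 + b.imJ ^ 2 + b.imK ^ 2 ∧
        a.re * b.re + a.imI * b.imI + a.imJ * b.imJ + a.imK * b.imK = 0 := by
  rw [complexNormSq, Complex.ext_iff]
  simp only [pow_two, Complex.add_re, Complex.add_im, Complex.mul_re, Complex.mul_im,
    Complex.ofReal_re, Complex.ofReal_im, Complex.I_re, Complex.I_im, Complex.zero_re,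
    Complex.zero_im]
  constructor <;> rintro ⟨h1, h2⟩ <;> constructor <;> linarith

theorem complexNormSq_neg_right (a b : ℍ[ℝ]) :
    complexNormSq a (-b) = 0 ↔ complexNormSq a b = 0 := by
  simp only [complexNormSq_eq_zero_iff, Quaternion.re_neg, Quaternion.imI_neg, Quaternion.imJ_neg,
    Quaternion.imK_neg, neg_sq, mul_neg]
  refine and_congr_right fun _ => ?_
  constructor <;> intro h <;> linarith

theorem complexNormSq_zero_right (a : ℍ[ℝ]) : complexNormSq a 0 = 0 ↔ a = 0 := by
  rw [complexNormSq_eq_zero_iff, ← Quaternion.normSq_eq_zero, Quaternion.normSq_def']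
  simp

theorem HolStemAt.differentiableAt_complexNormSq {A B : Cn n → ℍ[ℝ]} {z : Cn n}
    (h : HolStemAt A B z) : DifferentiableAt ℂ (fun w => complexNormSq (A w) (B w)) z :=
  ((((h.differentiableAt (QuaternionAlgebra.reₗ _ _ _)).pow 2).add
    ((h.differentiableAt (QuaternionAlgebra.imIₗ _ _ _)).pow 2)).add
    ((h.differentiableAt (QuaternionAlgebra.imJₗ _ _ _)).pow 2)).add
    ((h.differentiableAt (QuaternionAlgebra.imKₗ _ _ _)).pow 2)

theorem ImUnit.mul_self (I : ImUnit) : (I : ℍ[ℝ]) * I = -1 := by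
  rw [← sq]; exact I.2

/-- `h : ℂⁿ → ℍ` is holomorphic at `z` for the complex structure on `ℍ` given by left
multiplication by `I`. -/
def SliceHolAt (I : ImUnit) (h : Cn n → ℍ[ℝ]) (z : Cn n) : Prop :=
  ∃ D : Cn n →L[ℝ] ℍ[ℝ], HasFDerivAt h D z ∧ ∀ v, D (Complex.I • v) = I * D v

/-- Multiplication by `-I` turns an `I`-holomorphic function into the second component of a
holomorphic stem. -/
theorem SliceHolAt.holStemAt {I : ImUnit} {h : Cn n → ℍ[ℝ]} {z : Cn n} (hh : SliceHolAt I h z) :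
    HolStemAt h (fun w => -(I : ℍ[ℝ]) * h w) z := by
  obtain ⟨D, hD, hDI⟩ := hh
  refine ⟨D, (ContinuousLinearMap.mul ℝ ℍ[ℝ] (-(I : ℍ[ℝ]))).comp D, hD,
    (ContinuousLinearMap.mul ℝ ℍ[ℝ] (-(I : ℍ[ℝ]))).hasFDerivAt.comp z hD, fun v => ⟨?_, ?_⟩⟩
  · simp [hDI]
  · simp [hDI, ← mul_assoc, ImUnit.mul_self]

/-- The identity principle for `I`-holomorphic functions along a path that starts in `ℝⁿ`. -/
theorem SliceHolAt.eventually_eq_zero {I : ImUnit} {h : Cn n → ℍ[ℝ]} {U : Set (Cn n)}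
    (hU : IsOpen U) (hd : ∀ z ∈ U, SliceHolAt I h z) (γ : C(unitInterval, Cn n))
    (hγ : ∀ t, γ t ∈ U) (hr : IsRealVec (γ 0)) (h0 : ∀ᶠ w in 𝓝 (γ 0), IsRealVec w → h w = 0)
    (t : unitInterval) : ∀ᶠ w in 𝓝 (γ t), h w = 0 := by
  have key (φ : ℍ[ℝ] →ₗ[ℝ] ℝ) : ∀ᶠ w in 𝓝 (γ t), φ (h w) = 0 := by
    have hdφ : DifferentiableOn ℂ
        (fun w => (φ (h w) : ℂ) + φ (-(I : ℍ[ℝ]) * h w) * Complex.I) U := fun z hz =>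
      ((hd z hz).holStemAt.differentiableAt φ).differentiableWithinAt
    have := eventually_eq_zero_along_path hU hdφ γ hγ 0
      (eventually_eq_zero_of_real hU hdφ (hγ 0) hr (h0.mono fun w hw hwr => by simp [hw hwr])) t
    filter_upwards [this] with w hw
    simpa using congrArg Complex.re hw
  filter_upwards [key (QuaternionAlgebra.reₗ _ _ _), key (QuaternionAlgebra.imIₗ _ _ _),
    key (QuaternionAlgebra.imJₗ _ _ _), key (QuaternionAlgebra.imKₗ _ _ _)] with w h1 h2 h3 h4
  exact QuaternionAlgebra.ext h1 h2 h3 h4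

theorem HolStemAt.sliceHolAt {A B : Cn n → ℍ[ℝ]} {z : Cn n} (h : HolStemAt A B z) (K : ImUnit) :
    SliceHolAt K (fun w => A w + K * B w) z := by
  obtain ⟨A', B', hA, hB, hAB⟩ := h
  refine ⟨A' + (ContinuousLinearMap.mul ℝ ℍ[ℝ] (K : ℍ[ℝ])).comp B',
    hA.add ((ContinuousLinearMap.mul ℝ ℍ[ℝ] (K : ℍ[ℝ])).hasFDerivAt.comp z hB), fun v => ?_⟩
  simp only [add_apply, ContinuousLinearMap.comp_apply, ContinuousLinearMap.mul_apply', hAB,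
    mul_add, ← mul_assoc, ImUnit.mul_self]
  simp [add_comm]

theorem SliceHolAt.sub {I : ImUnit} {g h : Cn n → ℍ[ℝ]} {z : Cn n} (hg : SliceHolAt I g z)
    (hh : SliceHolAt I h z) : SliceHolAt I (fun w => g w - h w) z := by
  obtain ⟨D, hD, hDI⟩ := hg
  obtain ⟨D', hD', hDI'⟩ := hh
  exact ⟨D - D', hD.sub hD', fun v => by simp [hDI, hDI', mul_sub]⟩

theorem IsSliceRegular.sliceHolAt {Ω : Set (SliceCone n)} {f : SliceCone n → ℍ[ℝ]}
    (hf : IsSliceRegular Ω f) {I : ImUnit} {z : Cn n} (hz : z ∈ sliceOf I Ω) :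
    SliceHolAt I (fun w => f (psi I w)) z := by
  obtain ⟨hd, hcr⟩ := hf I z hz
  refine ⟨_, hd.hasFDerivAt, ?_⟩
  set D := fderiv ℝ (fun w : Cn n => f (psi I w)) z
  have hl (l : Fin n) :
      D (EuclideanSpace.single l Complex.I) = I * D (EuclideanSpace.single l 1) := by
    have h1 := (smul_eq_zero.1 (hcr l)).resolve_left (by norm_num)
    have h2 : (I : ℍ[ℝ]) * (D (EuclideanSpace.single l 1) +
      I * D (EuclideanSpace.single l Complex.I)) = 0 := by rw [h1, mul_zero]
    rw [mul_add, ← mul_assoc, ImUnit.mul_self, neg_one_mul, add_neg_eq_zero] at h2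
    exact h2.symm
  have hv (v : Cn n) : v = ∑ l, ((v l).re • EuclideanSpace.single l (1 : ℂ) +
      (v l).im • EuclideanSpace.single l Complex.I) := by
    ext k
    have : ∀ l, ((v l).re • EuclideanSpace.single l (1 : ℂ) +
        (v l).im • EuclideanSpace.single l Complex.I : Cn n) k = if k = l then v l else 0 := by
      intro l
      by_cases h : k = l <;> simp [h]
    rw [WithLp.ofLp_sum, Finset.sum_apply, Finset.sum_congr rfl fun l _ => this l]
    simp
  intro v
  have hIv : Complex.I • v = ∑ l, ((v l).re • EuclideanSpace.single l Complex.I -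
      (v l).im • EuclideanSpace.single l (1 : ℂ)) := by
    rw [hv (Complex.I • v)]
    refine Finset.sum_congr rfl fun l _ => ?_
    simp [add_comm, sub_eq_add_neg]
  rw [hIv]
  conv_rhs => rw [hv v]
  simp only [map_sum, map_add, map_sub, map_smul, hl, Finset.mul_sum, mul_add, mul_smul_comm,
    ← mul_assoc, ImUnit.mul_self]
  simp [sub_eq_add_neg]

/-! ### The stem determined by two slices -/

/-- The second component of the solution of `a + I b = f(z^I)`, `a + J b = f(z^J)`. -/
noncomputable def stemB (f : SliceCone n → ℍ[ℝ]) (I J : ImUnit) (z : Cn n) : ℍ[ℝ] :=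
  ((I : ℍ[ℝ]) - J)⁻¹ * (f (psi I z) - f (psi J z))

/-- The first component of the solution of `a + I b = f(z^I)`, `a + J b = f(z^J)`. -/
noncomputable def stemA (f : SliceCone n → ℍ[ℝ]) (I J : ImUnit) (z : Cn n) : ℍ[ℝ] :=
  f (psi I z) - I * stemB f I J z

theorem ImUnit.sub_ne_zero {I J : ImUnit} (h : I ≠ J) : (I : ℍ[ℝ]) - J ≠ 0 :=
  fun h' => h (Subtype.ext (_root_.sub_eq_zero.1 h'))

theorem stemA_add_left (f : SliceCone n → ℍ[ℝ]) (I J : ImUnit) (z : Cn n) :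
    stemA f I J z + I * stemB f I J z = f (psi I z) := by
  simp [stemA]

theorem stemA_add_right (f : SliceCone n → ℍ[ℝ]) {I J : ImUnit} (h : I ≠ J) (z : Cn n) :
    stemA f I J z + J * stemB f I J z = f (psi J z) := by
  have : ((I : ℍ[ℝ]) - J) * stemB f I J z = f (psi I z) - f (psi J z) := by
    rw [stemB, mul_inv_cancel_left₀ (ImUnit.sub_ne_zero h)]
  rw [sub_mul] at this
  rw [stemA, sub_add, this, sub_sub_cancel]

theorem stem_unique {I J : ImUnit} (h : I ≠ J) {a b a' b' : ℍ[ℝ]}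
    (hI : a + I * b = a' + I * b') (hJ : a + J * b = a' + J * b') : a = a' ∧ b = b' := by
  have hb : ((I : ℍ[ℝ]) - J) * b = (I - J) * b' := by
    have := congrArg₂ (· - ·) hI hJ
    simpa only [add_sub_add_left_eq_sub, ← sub_mul] using this
  have hb' := mul_left_cancel₀ (ImUnit.sub_ne_zero h) hb
  subst hb'
  exact ⟨add_right_cancel hI, rfl⟩

theorem IsSliceRegular.holStemAt {Ω : Set (SliceCone n)} {f : SliceCone n → ℍ[ℝ]}
    (hf : IsSliceRegular Ω f) {I J : ImUnit} (hIJ : I ≠ J) {z : Cn n} (hI : z ∈ sliceOf I Ω)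
    (hJ : z ∈ sliceOf J Ω) : HolStemAt (stemA f I J) (stemB f I J) z := by
  obtain ⟨D, hD, hDI⟩ := hf.sliceHolAt hI
  obtain ⟨D', hD', hDJ⟩ := hf.sliceHolAt hJ
  let B' := (ContinuousLinearMap.mul ℝ ℍ[ℝ] ((I : ℍ[ℝ]) - J)⁻¹).comp (D - D')
  have hB : HasFDerivAt (stemB f I J) B' z :=
    (ContinuousLinearMap.mul ℝ ℍ[ℝ] ((I : ℍ[ℝ]) - J)⁻¹).hasFDerivAt.comp z (hD.sub hD')
  let A' := D - (ContinuousLinearMap.mul ℝ ℍ[ℝ] (I : ℍ[ℝ])).comp B'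
  have hA : HasFDerivAt (stemA f I J) A' z :=
    hD.sub ((ContinuousLinearMap.mul ℝ ℍ[ℝ] (I : ℍ[ℝ])).hasFDerivAt.comp z hB)
  have hBv (v) : ((I : ℍ[ℝ]) - J) * B' v = D v - D' v :=
    mul_inv_cancel_left₀ (ImUnit.sub_ne_zero hIJ) _
  have hAv (v) : A' v = D v - I * B' v := rfl
  have hBI (v) : B' (Complex.I • v) = A' v := by
    refine mul_left_cancel₀ (ImUnit.sub_ne_zero hIJ) ?_
    have h1 : ((I : ℍ[ℝ]) - J) * I = -(J * (I - J)) := by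
      rw [sub_mul, mul_sub, ImUnit.mul_self, ImUnit.mul_self]
      abel
    rw [hBv, hDI, hDJ, hAv, mul_sub, ← mul_assoc, h1, neg_mul, mul_assoc, hBv, sub_mul, mul_sub]
    abel
  refine ⟨A', B', hA, hB, fun v => ⟨?_, hBI v⟩⟩
  rw [hAv, hBI, hDI, hAv, mul_sub, ← mul_assoc, ImUnit.mul_self]
  simp

/-! ### Points of the slice cone -/

/-- Componentwise complex conjugation on `ℂⁿ`. -/
def conjVec (z : Cn n) : Cn n := WithLp.toLp 2 fun l => star (z l)

theorem continuous_conjVec : Continuous (conjVec (n := n)) := by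
  unfold conjVec
  fun_prop

theorem conjVec_of_isRealVec {z : Cn n} (h : IsRealVec z) : conjVec z = z := by
  ext l
  exact Complex.conj_eq_iff_im.2 (h l)

def negUnit (I : ImUnit) : ImUnit := ⟨-I, by rw [neg_sq]; exact I.2⟩

@[simp] theorem coe_negUnit (I : ImUnit) : (negUnit I : ℍ[ℝ]) = -I := rfl

@[simp] theorem negUnit_negUnit (I : ImUnit) : negUnit (negUnit I) = I := Subtype.ext (neg_neg _)

theorem psi_eq_iff {I J : ImUnit} {z w : Cn n} :
    psi I z = psi J w ↔ ∀ l, ((z l).re : ℍ[ℝ]) + ((z l).im : ℍ[ℝ]) * (I : ℍ[ℝ]) =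
      ((w l).re : ℍ[ℝ]) + ((w l).im : ℍ[ℝ]) * (J : ℍ[ℝ]) := by
  exact Subtype.ext_iff.trans ((WithLp.toLp_injective 2).eq_iff.trans funext_iff)

@[simp] theorem psi_negUnit_conjVec (I : ImUnit) (z : Cn n) : psi (negUnit I) (conjVec z) = psi I z := by
  rw [psi_eq_iff]
  intro l
  simp [conjVec]

theorem psi_of_isRealVec {z : Cn n} (h : IsRealVec z) (I J : ImUnit) : psi I z = psi J z := by
  rw [psi_eq_iff]
  intro l
  simp [h l]

theorem ImUnit.re_eq_zero (I : ImUnit) : (I : ℍ[ℝ]).re = 0 := by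
  have h2 : Quaternion.normSq (I : ℍ[ℝ]) = 1 := by
    have := congrArg Quaternion.normSq I.2
    rw [map_pow, Quaternion.normSq_neg, map_one] at this
    exact (pow_eq_one_iff_of_nonneg Quaternion.normSq_nonneg two_ne_zero).1 this
  refine Quaternion.sq_eq_neg_normSq.1 ?_
  rw [I.2, h2, Quaternion.coe_one]

theorem ImUnit.norm_eq_one (I : ImUnit) : ‖(I : ℍ[ℝ])‖ = 1 := by
  have := congrArg norm I.2
  rw [norm_pow, norm_neg, norm_one] at this
  exact (pow_eq_one_iff_of_nonneg (norm_nonneg _) two_ne_zero).1 this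

theorem ImUnit.ne_zero (I : ImUnit) : (I : ℍ[ℝ]) ≠ 0 :=
  norm_ne_zero_iff.1 (by rw [I.norm_eq_one]; exact one_ne_zero)

theorem psi_coord_im (I : ImUnit) (z : Cn n) (l : Fin n) :
    ((psi I z).toVec l).im = ((z l).im : ℍ[ℝ]) * I := by
  have : (psi I z).toVec l = ((z l).re : ℍ[ℝ]) + ((z l).im : ℍ[ℝ]) * (I : ℍ[ℝ]) := rfl
  rw [this]
  ext <;> simp [I.re_eq_zero]

theorem isRealPt_psi {I : ImUnit} {z : Cn n} : IsRealPt (psi I z) ↔ IsRealVec z := by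
  refine forall_congr' fun l => ?_
  rw [psi_coord_im, mul_eq_zero, or_iff_left I.ne_zero]
  exact Quaternion.coe_injective.eq_iff' rfl

/-- Two representations of the same point of the slice cone agree up to the conjugation
`(I, z) ↦ (-I, z̄)`, unless the point is real. -/
theorem psi_eq_psi {I J : ImUnit} {z w : Cn n} (h : psi I z = psi J w) :
    (IsRealVec w ∧ z = w) ∨ (J = I ∧ z = w) ∨ (J = negUnit I ∧ z = conjVec w) := by
  rw [psi_eq_iff] at h
  have hre (l) : (z l).re = (w l).re := by
    have := congrArg (fun q : ℍ[ℝ] => q.re) (h l)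
    simpa [I.re_eq_zero, J.re_eq_zero] using this
  have him (l) : ((z l).im : ℍ[ℝ]) * (I : ℍ[ℝ]) = ((w l).im : ℍ[ℝ]) * J := by
    have := h l
    rw [hre] at this
    exact add_left_cancel this
  have habs (l) : |(z l).im| = |(w l).im| := by
    have := congrArg norm (him l)
    simpa [I.norm_eq_one, J.norm_eq_one] using this
  by_cases hw : IsRealVec w
  · refine Or.inl ⟨hw, ?_⟩
    ext l
    refine Complex.ext (hre l) ?_
    rw [hw l, ← abs_eq_zero, habs, hw l, abs_zero]
  refine Or.inr ?_
  obtain ⟨k, hk⟩ := not_forall.1 hw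
  have hk' : ((w k).im : ℍ[ℝ]) ≠ 0 := (Quaternion.coe_injective.ne_iff' rfl).2 hk
  rcases abs_eq_abs.1 (habs k) with hk1 | hk1
  · have hJI : J = I := by
      have := him k
      rw [hk1] at this
      exact Subtype.ext (mul_left_cancel₀ hk' this).symm
    refine Or.inl ⟨hJI, ?_⟩
    ext l
    refine Complex.ext (hre l) ?_
    have := him l
    rw [hJI] at this
    exact Quaternion.coe_injective (mul_right_cancel₀ I.ne_zero this)
  · have hJI : J = negUnit I := by
      have := him k
      rw [hk1, Quaternion.coe_neg, neg_mul_comm] at this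
      exact Subtype.ext (mul_left_cancel₀ hk' this).symm
    refine Or.inr ⟨hJI, ?_⟩
    ext l
    refine Complex.ext (hre l) ?_
    have := him l
    rw [hJI, coe_negUnit, ← neg_mul_comm, ← Quaternion.coe_neg] at this
    exact Quaternion.coe_injective (mul_right_cancel₀ I.ne_zero this)

theorem psi_injective (I : ImUnit) : Function.Injective (psi (n := n) I) := by
  intro z w h
  rcases psi_eq_psi h with h1 | h1 | h1
  · exact h1.2
  · exact h1.2
  · have h2 : (I : ℍ[ℝ]) = -I := congrArg Subtype.val h1.1
    rw [eq_neg_iff_add_eq_zero, ← two_smul ℝ, smul_eq_zero] at h2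
    exact (h2.elim two_ne_zero I.ne_zero).elim

theorem frakI_of_isRealVec {I : ImUnit} {z : Cn n} (h : IsRealVec z) : frakI (psi I z) = 0 := by
  rw [frakI, dif_neg]
  rintro ⟨l, hl⟩
  exact hl (isRealPt_psi.2 h l)

theorem frakI_psi {I : ImUnit} {z : Cn n} (h : ¬ IsRealVec z) :
    frakI (psi I z) = I ∨ frakI (psi I z) = -I := by
  classical
  have hex : ∃ l, ((psi I z).toVec l).im ≠ 0 := by
    rw [← isRealPt_psi (I := I)] at h
    exact not_forall.1 h
  rw [frakI, dif_pos hex]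
  have hne := Fin.find_spec hex
  set k := Fin.find _ hex
  rw [psi_coord_im] at hne ⊢
  have hs : (z k).im ≠ 0 := by
    intro h0
    simp [h0] at hne
  rw [norm_mul, I.norm_eq_one, mul_one, Quaternion.norm_coe, ← Quaternion.coe_mul_eq_smul,
    ← mul_assoc, ← Quaternion.coe_mul, Real.norm_eq_abs]
  rcases abs_choice (z k).im with h1 | h1
  · left
    rw [h1, inv_mul_cancel₀ hs]; simp
  · right
    rw [h1, inv_neg, neg_mul, inv_mul_cancel₀ hs]; simp

theorem dist_psi (I : ImUnit) (z w : Cn n) : dist (psi I z).toVec (psi I w).toVec = dist z w := by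
  rw [PiLp.dist_eq_of_L2, PiLp.dist_eq_of_L2]
  congr 1
  refine Finset.sum_congr rfl fun l _ => ?_
  have h1 : (psi I z).toVec l - (psi I w).toVec l =
      ((z l - w l).re : ℍ[ℝ]) + ((z l - w l).im : ℍ[ℝ]) * (I : ℍ[ℝ]) := by
    change (((z l).re : ℍ[ℝ]) + ((z l).im : ℍ[ℝ]) * (I : ℍ[ℝ])) -
      (((w l).re : ℍ[ℝ]) + ((w l).im : ℍ[ℝ]) * (I : ℍ[ℝ])) = _
    simp [sub_mul]
    abel
  have hI : (I : ℍ[ℝ]).imI ^ 2 + (I : ℍ[ℝ]).imJ ^ 2 + (I : ℍ[ℝ]).imK ^ 2 = 1 := by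
    have := Quaternion.normSq_eq_norm_mul_self (I : ℍ[ℝ])
    rw [I.norm_eq_one, Quaternion.normSq_def', I.re_eq_zero] at this
    linarith
  rw [dist_eq_norm, dist_eq_norm, h1, sq, sq, ← Quaternion.normSq_eq_norm_mul_self,
    Quaternion.normSq_def', ← sq, Complex.sq_norm, Complex.normSq_apply]
  simp [I.re_eq_zero]
  linear_combination ((z l).im - (w l).im) ^ 2 * hI

theorem sliceBall_psi (I : ImUnit) (p : Cn n) (r : ℝ) :
    sliceBall I (psi I p) r = psi I '' Metric.ball p r := by
  ext q
  constructor
  · rintro ⟨⟨z, rfl⟩, hz⟩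
    exact ⟨z, by rwa [dist_psi] at hz, rfl⟩
  · rintro ⟨z, hz, rfl⟩
    exact ⟨⟨z, rfl⟩, by rwa [dist_psi]⟩

/-! ### Operations on paths -/

theorem RealPath.isRealVec_zero (γ : RealPath n) : IsRealVec (γ.1 0) := γ.2

/-- The complex conjugate of a path. -/
noncomputable def RealPath.conj (γ : RealPath n) : RealPath n :=
  ⟨⟨fun t => conjVec (γ.1 t), continuous_conjVec.comp γ.1.continuous⟩, fun l => by
    simp [conjVec, γ.2 l]⟩

theorem mem_unitsOf_conj {Ω : Set (SliceCone n)} {γ : RealPath n} {I : ImUnit} :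
    negUnit I ∈ unitsOf Ω γ.conj ↔ I ∈ unitsOf Ω γ := by
  refine forall_congr' fun t => ?_
  change psi (negUnit I) (conjVec (γ.1 t)) ∈ Ω ↔ _
  rw [psi_negUnit_conjVec]

theorem unitsOf_eq (Ω : Set (SliceCone n)) (γ : RealPath n) :
    unitsOf Ω γ = {I | Set.range γ.1 ⊆ sliceOf I Ω} := by
  ext I
  exact (Set.range_subset_iff (f := γ.1) (s := sliceOf I Ω)).symm

theorem RealPath.exists_append (α : RealPath n) {z : Cn n} (p : Path (endPt α) z) :
    ∃ β : RealPath n, β.1 0 = α.1 0 ∧ endPt β = z ∧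
      Set.range β.1 = Set.range α.1 ∪ Set.range p := by
  let a : Path (α.1 0) (endPt α) := ⟨α.1, rfl, rfl⟩
  refine ⟨⟨(a.trans p).toContinuousMap, fun l => ?_⟩, (a.trans p).source, (a.trans p).target,
    a.trans_range p⟩
  exact (congrArg (fun v : Cn n => (v l).im) (a.trans p).source).trans (α.2 l)

theorem RealPath.exists_segment (α : RealPath n) (z : Cn n) :
    ∃ β : RealPath n, β.1 0 = α.1 0 ∧ endPt β = z ∧ ∀ (I : ImUnit) (Ω : Set (SliceCone n)) (r : ℝ),
      I ∈ unitsOf Ω α → Metric.ball (endPt α) r ⊆ sliceOf I Ω → z ∈ Metric.ball (endPt α) r →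
        I ∈ unitsOf Ω β := by
  obtain ⟨β, h0, h1, hr⟩ := α.exists_append (Path.segment (endPt α) z)
  refine ⟨β, h0, h1, fun I Ω r hI hb hz => ?_⟩
  rw [unitsOf_eq] at hI ⊢
  rw [Set.mem_ofPred_eq, hr, Path.range_segment]
  refine Set.union_subset hI (Set.Subset.trans ?_ hb)
  exact (convex_ball _ _).segment_subset
    (Metric.mem_ball_self (dist_nonneg.trans_lt (Metric.mem_ball.1 hz))) hz

theorem RealPath.exists_reverse (α : RealPath n) (h : IsRealVec (endPt α)) :
    ∃ β : RealPath n, β.1 0 = endPt α ∧ endPt β = α.1 0 ∧ Set.range β.1 = Set.range α.1 := by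
  let a : Path (α.1 0) (endPt α) := ⟨α.1, rfl, rfl⟩
  refine ⟨⟨a.symm.toContinuousMap, fun l => ?_⟩, a.symm.source, a.symm.target, a.symm_range⟩
  exact (congrArg (fun v : Cn n => (v l).im) a.symm.source).trans (h l)

/-- Running through `α` and then backwards through `β`. -/
theorem RealPath.exists_append_reverse (α β : RealPath n) (h : endPt α = endPt β) :
    ∃ δ : RealPath n, δ.1 0 = α.1 0 ∧ endPt δ = β.1 0 ∧
      ∀ Ω : Set (SliceCone n), unitsOf Ω δ = unitsOf Ω α ∩ unitsOf Ω β := by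
  let b : Path (β.1 0) (endPt α) := ⟨β.1, rfl, h.symm⟩
  obtain ⟨δ, h0, h1, hr⟩ := α.exists_append b.symm
  refine ⟨δ, h0, h1, fun Ω => ?_⟩
  have hb : Set.range b.symm = Set.range β.1 := b.symm_range
  ext I
  simp [unitsOf_eq, hr, hb]

/-- The constant path at a real point. -/
noncomputable def RealPath.const (z : Cn n) (h : IsRealVec z) : RealPath n := ⟨.const _ z, h⟩

/-! ### Slice regular functions are path-slice -/

theorem stem_of_isRealVec (f : SliceCone n → ℍ[ℝ]) (I J K : ImUnit) {z : Cn n} (h : IsRealVec z) :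
    stemA f I J z = f (psi K z) ∧ stemB f I J z = 0 := by
  have hB : stemB f I J z = 0 := by
    rw [stemB, psi_of_isRealVec h J I, sub_self, mul_zero]
  rw [stemA, hB, psi_of_isRealVec h K I]
  simp

/-- With two units `I ≠ J` along `γ`, the functions `f(z^K)` and `a(z) + K b(z)`, where `(a, b)` is
the stem determined by `I` and `J`, are both `K`-holomorphic near `γ` and agree on `ℝⁿ`. -/
theorem IsSliceRegular.isPathSlice {Ω : Set (SliceCone n)} {f : SliceCone n → ℍ[ℝ]}
    (hΩ : IsOpen Ω) (hf : IsSliceRegular Ω f) : IsPathSlice Ω f := by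
  have key (γ : RealPath n) : ∃ p : ℍ[ℝ] × ℍ[ℝ], ∀ K ∈ unitsOf Ω γ,
      f (psi K (endPt γ)) = p.1 + (K : ℍ[ℝ]) * p.2 := by
    by_cases h : ∃ I J, I ∈ unitsOf Ω γ ∧ J ∈ unitsOf Ω γ ∧ I ≠ J
    · obtain ⟨I, J, hI, hJ, hIJ⟩ := h
      refine ⟨(stemA f I J (endPt γ), stemB f I J (endPt γ)), fun K hK => ?_⟩
      have := SliceHolAt.eventually_eq_zero (I := K)
        (h := fun w => f (psi K w) - (stemA f I J w + K * stemB f I J w))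
        (((hΩ I).inter (hΩ J)).inter (hΩ K))
        (fun z hz => (hf.sliceHolAt hz.2).sub ((hf.holStemAt hIJ hz.1.1 hz.1.2).sliceHolAt K))
        γ.1 (fun t => ⟨⟨hI t, hJ t⟩, hK t⟩) γ.isRealVec_zero
        (Eventually.of_forall fun w hw => by
          rw [(stem_of_isRealVec f I J K hw).1, (stem_of_isRealVec f I J K hw).2]
          simp) 1
      exact sub_eq_zero.1 this.self_of_nhds
    · by_cases h2 : ∃ I, I ∈ unitsOf Ω γ
      · obtain ⟨I, hI⟩ := h2
        refine ⟨(f (psi I (endPt γ)), 0), fun K hK => ?_⟩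
        have hKI : K = I := by
          by_contra hne
          exact h ⟨K, I, hK, hI, hne⟩
        simp [hKI]
      · exact ⟨0, fun K hK => (h2 ⟨K, hK⟩).elim⟩
  choose F hF using key
  exact ⟨F, fun γ _ => hF γ⟩

/-! ### Stem functions of stem-preserving pairs -/

section Stem

variable {Ω₁ Ω₂ : Set (SliceCone n)} {f : SliceCone n → ℍ[ℝ]} {F : RealPath n → ℍ[ℝ] × ℍ[ℝ]}

theorem IsStemPreserving.exists_units (hS : IsStemPreserving Ω₁ Ω₂) {γ : RealPath n}
    (hγ : γ ∈ pathsIn Ω₁) : ∃ I J, I ∈ unitsOf Ω₂ γ ∧ J ∈ unitsOf Ω₂ γ ∧ I ≠ J :=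
  Set.one_lt_encard_iff.1 (lt_of_lt_of_le (by norm_num) (hS.1 γ hγ))

theorem IsStemFunction.apply_eq (hF : IsStemFunction Ω₂ f F) {γ : RealPath n} {I : ImUnit}
    (hI : I ∈ unitsOf Ω₂ γ) : f (psi I (endPt γ)) = (F γ).1 + (I : ℍ[ℝ]) * (F γ).2 :=
  hF γ ⟨I, hI⟩ I hI

theorem IsStemFunction.eq_stem (hF : IsStemFunction Ω₂ f F) {γ : RealPath n} {I J : ImUnit}
    (hI : I ∈ unitsOf Ω₂ γ) (hJ : J ∈ unitsOf Ω₂ γ) (hIJ : I ≠ J) :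
    F γ = (stemA f I J (endPt γ), stemB f I J (endPt γ)) := by
  obtain ⟨h1, h2⟩ := stem_unique hIJ
    ((hF.apply_eq hI).symm.trans (stemA_add_left f I J (endPt γ)).symm)
    ((hF.apply_eq hJ).symm.trans (stemA_add_right f hIJ (endPt γ)).symm)
  exact Prod.ext h1 h2

/-- Two paths to the same point in a common slice of `Ω₁` have the same stem: running through one
and backwards through the other is a path in `Ω₁`, so at least two units serve both in `Ω₂`. -/
theorem IsStemFunction.congr_path (hF : IsStemFunction Ω₂ f F) (hS : IsStemPreserving Ω₁ Ω₂)
    {α β : RealPath n} {I : ImUnit} (hα : I ∈ unitsOf Ω₁ α) (hβ : I ∈ unitsOf Ω₁ β)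
    (h : endPt α = endPt β) : F α = F β := by
  obtain ⟨δ, -, -, hδ⟩ := α.exists_append_reverse β h
  obtain ⟨J, K, hJ, hK, hJK⟩ := hS.exists_units (γ := δ) ⟨I, by rw [hδ]; exact ⟨hα, hβ⟩⟩
  rw [hδ] at hJ hK
  rw [hF.eq_stem hJ.1 hK.1 hJK, hF.eq_stem hJ.2 hK.2 hJK, h]

theorem IsStemFunction.conj_path (hF : IsStemFunction Ω₂ f F) (hS : IsStemPreserving Ω₁ Ω₂)
    {γ : RealPath n} (hγ : γ ∈ pathsIn Ω₁) : F γ.conj = ((F γ).1, -(F γ).2) := by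
  obtain ⟨I, J, hI, hJ, hIJ⟩ := hS.exists_units hγ
  have key {K : ImUnit} (hK : K ∈ unitsOf Ω₂ γ) :
      (F γ.conj).1 + negUnit K * (F γ.conj).2 = (F γ).1 + negUnit K * -(F γ).2 := by
    rw [← hF.apply_eq (mem_unitsOf_conj.2 hK), coe_negUnit, neg_mul_neg, ← hF.apply_eq hK]
    exact congrArg f (psi_negUnit_conjVec K (endPt γ))
  obtain ⟨h1, h2⟩ := stem_unique (fun h => hIJ (by simpa using congrArg negUnit h)) (key hI) (key hJ)
  exact Prod.ext h1 h2

theorem IsStemFunction.of_isRealVec (hF : IsStemFunction Ω₂ f F) (hS : IsStemPreserving Ω₁ Ω₂)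
    {γ : RealPath n} (hγ : γ ∈ pathsIn Ω₁) (h : IsRealVec (endPt γ)) (K : ImUnit) :
    F γ = (f (psi K (endPt γ)), 0) := by
  obtain ⟨I, J, hI, hJ, hIJ⟩ := hS.exists_units hγ
  rw [hF.eq_stem hI hJ hIJ, (stem_of_isRealVec f I J K h).1, (stem_of_isRealVec f I J K h).2]

theorem scrF_eq (hF : IsStemFunction Ω₂ f (stemFun Ω₂ f)) (hS : IsStemPreserving Ω₁ Ω₂)
    {γ : RealPath n} {I : ImUnit} (hI : I ∈ unitsOf Ω₁ γ) (h : ¬ IsRealVec (endPt γ)) :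
    (frakI (psi I (endPt γ)) = I ∧ scrF Ω₁ Ω₂ f (psi I (endPt γ)) = stemFun Ω₂ f γ) ∨
      (frakI (psi I (endPt γ)) = negUnit I ∧ scrF Ω₁ Ω₂ f (psi I (endPt γ)) =
        ((stemFun Ω₂ f γ).1, -(stemFun Ω₂ f γ).2)) := by
  rw [scrF, if_neg (mt isRealPt_psi.1 h)]
  rcases frakI_psi (I := I) h with hfr | hfr
  · have hex : ∃ δ : RealPath n, ∃ K ∈ unitsOf Ω₁ δ,
        (K : ℍ[ℝ]) = frakI (psi I (endPt γ)) ∧ psi K (endPt δ) = psi I (endPt γ) :=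
      ⟨γ, I, hI, hfr.symm, rfl⟩
    rw [dif_pos hex]
    obtain ⟨K, hK, hKI, hKe⟩ := hex.choose_spec
    obtain rfl : K = I := Subtype.ext (hKI.trans hfr)
    exact Or.inl ⟨hfr, hF.congr_path hS hK hI (psi_injective _ hKe)⟩
  · have hex : ∃ δ : RealPath n, ∃ K ∈ unitsOf Ω₁ δ,
        (K : ℍ[ℝ]) = frakI (psi I (endPt γ)) ∧ psi K (endPt δ) = psi I (endPt γ) :=
      ⟨γ.conj, negUnit I, mem_unitsOf_conj.2 hI, hfr.symm, psi_negUnit_conjVec I (endPt γ)⟩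
    rw [dif_pos hex]
    obtain ⟨K, hK, hKI, hKe⟩ := hex.choose_spec
    obtain rfl : K = negUnit I := Subtype.ext (hKI.trans hfr)
    refine Or.inr ⟨hfr, ?_⟩
    rw [← hF.conj_path hS ⟨I, hI⟩]
    exact hF.congr_path hS hK (mem_unitsOf_conj.2 hI)
      (psi_injective _ (hKe.trans (psi_negUnit_conjVec I (endPt γ)).symm))

/-- For a unit `u`, the symmetrization of the stem `(a, b)` is `|a|² - |b|² + 2 u ⟨a, b⟩`. -/
theorem symmetrization_stem_eq_zero_iff (u : ImUnit) (a b : ℍ[ℝ]) :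
    (star a + u * star b) * a + u * (star a + u * star b) * b = 0 ↔ complexNormSq a b = 0 := by
  have h : (star a + u * star b) * a + u * (star a + u * star b) * b =
      ((a.re ^ 2 + a.imI ^ 2 + a.imJ ^ 2 + a.imK ^ 2 -
        (b.re ^ 2 + b.imI ^ 2 + b.imJ ^ 2 + b.imK ^ 2) : ℝ) : ℍ[ℝ]) +
      u * ((2 * (a.re * b.re + a.imI * b.imI + a.imJ * b.imJ + a.imK * b.imK) : ℝ) : ℍ[ℝ]) := by
    have h1 : star b * a + star a * b =
        ((2 * (a.re * b.re + a.imI * b.imI + a.imJ * b.imJ + a.imK * b.imK) : ℝ) : ℍ[ℝ]) := by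
      ext <;> simp <;> ring
    have h2 : (star a + u * star b) * a + u * (star a + u * star b) * b =
        star a * a + u * (star b * a + star a * b) + (u * u : ℍ[ℝ]) * (star b * b) := by
      noncomm_ring
    rw [h2, h1, ImUnit.mul_self, Quaternion.star_mul_self, Quaternion.star_mul_self,
      Quaternion.normSq_def', Quaternion.normSq_def', Quaternion.coe_sub]
    noncomm_ring
  rw [h, complexNormSq_eq_zero_iff]
  constructor
  · intro h0
    have hre := congrArg (fun q : ℍ[ℝ] => q.re) h0
    simp only [Quaternion.re_add, Quaternion.re_coe, Quaternion.re_mul, u.re_eq_zero,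
      Quaternion.imI_coe, Quaternion.imJ_coe, Quaternion.imK_coe, Quaternion.re_zero] at hre
    have hre' : a.re ^ 2 + a.imI ^ 2 + a.imJ ^ 2 + a.imK ^ 2 -
        (b.re ^ 2 + b.imI ^ 2 + b.imJ ^ 2 + b.imK ^ 2) = 0 := by linarith
    rw [hre', Quaternion.coe_zero, zero_add, mul_eq_zero, or_iff_right u.ne_zero,
      ← Quaternion.coe_zero, Quaternion.coe_inj] at h0
    exact ⟨by linarith, by linarith⟩
  · rintro ⟨h1, h2⟩
    rw [h1, h2]
    simp

theorem symmetrization_eq_zero_iff (hF : IsStemFunction Ω₂ f (stemFun Ω₂ f))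
    (hS : IsStemPreserving Ω₁ Ω₂) {γ : RealPath n} {I : ImUnit} (hI : I ∈ unitsOf Ω₁ γ) :
    symmetrization Ω₁ Ω₂ f (psi I (endPt γ)) = 0 ↔
      complexNormSq (stemFun Ω₂ f γ).1 (stemFun Ω₂ f γ).2 = 0 := by
  rw [symmetrization, starProd, sliceConj]
  by_cases hr : IsRealVec (endPt γ)
  · rw [scrF, if_pos (isRealPt_psi.2 hr), frakI_of_isRealVec hr,
      hF.of_isRealVec hS ⟨I, hI⟩ hr I, complexNormSq_zero_right]
    simp
  · rcases scrF_eq hF hS hI hr with ⟨h1, h2⟩ | ⟨h1, h2⟩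
    · rw [h1, h2, symmetrization_stem_eq_zero_iff]
    · rw [h1, h2, symmetrization_stem_eq_zero_iff, complexNormSq_neg_right]

end Stem

/-! ### Vanishing near the real starting points of paths -/

section Vanishing

variable {Ω₁ Ω₂ : Set (SliceCone n)} {f : SliceCone n → ℍ[ℝ]}

/-- `f` vanishes on a neighbourhood of `x` in `ℝⁿ`. -/
def RealVanish (f : SliceCone n → ℍ[ℝ]) (x : Cn n) : Prop :=
  ∀ᶠ w in 𝓝 x, IsRealVec w → ∀ I : ImUnit, f (psi I w) = 0

theorem RealVanish.eventually_endPt (hΩ : IsOpen Ω₂) (hf : IsSliceRegular Ω₂ f) {γ : RealPath n}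
    {I : ImUnit} (hI : I ∈ unitsOf Ω₂ γ) (h : RealVanish f (γ.1 0)) :
    ∀ᶠ w in 𝓝 (endPt γ), f (psi I w) = 0 :=
  SliceHolAt.eventually_eq_zero (hΩ I) (fun _ hz => hf.sliceHolAt hz) γ.1 hI γ.isRealVec_zero
    (h.mono fun _ hw hr => hw hr I) 1

theorem RealVanish.endPt (hΩ : IsOpen Ω₂) (hf : IsSliceRegular Ω₂ f) {γ : RealPath n}
    (hγ : γ ∈ pathsIn Ω₂) (h : RealVanish f (γ.1 0)) : RealVanish f (endPt γ) := by
  obtain ⟨I, hI⟩ := hγ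
  filter_upwards [h.eventually_endPt hΩ hf hI] with w hw hr J
  rw [psi_of_isRealVec hr J I, hw]

theorem RealVanish.stem_eq_zero (hΩ : IsOpen Ω₂) (hf : IsSliceRegular Ω₂ f)
    (hS : IsStemPreserving Ω₁ Ω₂) {F : RealPath n → ℍ[ℝ] × ℍ[ℝ]} (hF : IsStemFunction Ω₂ f F)
    {γ : RealPath n} (hγ : γ ∈ pathsIn Ω₁) (h : RealVanish f (γ.1 0)) : F γ = 0 := by
  obtain ⟨I, J, hI, hJ, hIJ⟩ := hS.exists_units hγ
  rw [hF.eq_stem hI hJ hIJ, stemA, stemB, (h.eventually_endPt hΩ hf hI).self_of_nhds,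
    (h.eventually_endPt hΩ hf hJ).self_of_nhds]
  simp

/-- If `|a|² - |b|² + 2 i ⟨a, b⟩` vanishes near the end of `γ`, for the stem `(a, b)` determined
by two units along `γ`, then by continuation it vanishes near `γ(0)`, where on `ℝⁿ` it is `|f|²`. -/
theorem IsSliceRegular.realVanish_of_complexNormSq (hΩ : IsOpen Ω₂) (hf : IsSliceRegular Ω₂ f)
    {γ : RealPath n} {I J : ImUnit} (hI : I ∈ unitsOf Ω₂ γ) (hJ : J ∈ unitsOf Ω₂ γ) (hIJ : I ≠ J)
    (h : ∀ᶠ w in 𝓝 (endPt γ), complexNormSq (stemA f I J w) (stemB f I J w) = 0) :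
    RealVanish f (γ.1 0) := by
  have := eventually_eq_zero_along_path ((hΩ I).inter (hΩ J))
    (fun z hz => (hf.holStemAt hIJ hz.1 hz.2).differentiableAt_complexNormSq.differentiableWithinAt)
    γ.1 (fun t => ⟨hI t, hJ t⟩) 1 h 0
  filter_upwards [this] with w hw hr K
  rwa [(stem_of_isRealVec f I J K hr).1, (stem_of_isRealVec f I J K hr).2,
    complexNormSq_zero_right] at hw

/-! ### Connectedness of the domain -/

section Connected

variable {P : Cn n → Prop}

theorem exists_path_to_slice
    (hP : ∀ γ ∈ pathsIn Ω₁, IsRealVec (endPt γ) → P (γ.1 0) → P (endPt γ))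
    {γ : RealPath n} {I J : ImUnit} {z : Cn n} (hI : I ∈ unitsOf Ω₁ γ) (h0 : P (γ.1 0))
    (hz : psi J z = psi I (endPt γ)) :
    ∃ δ : RealPath n, J ∈ unitsOf Ω₁ δ ∧ endPt δ = z ∧ P (δ.1 0) := by
  rcases psi_eq_psi hz with ⟨hr, rfl⟩ | ⟨rfl, rfl⟩ | ⟨rfl, rfl⟩
  · refine ⟨RealPath.const _ hr, fun _ => ?_, rfl, hP γ ⟨I, hI⟩ hr h0⟩
    change psi J (endPt γ) ∈ Ω₁
    rw [hz]
    exact hI 1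
  · exact ⟨γ, hI, rfl, h0⟩
  · refine ⟨γ.conj, ?_, rfl, ?_⟩
    · simpa using mem_unitsOf_conj.2 hI
    · change P (conjVec (γ.1 0))
      rwa [conjVec_of_isRealVec γ.isRealVec_zero]

theorem isOpen_endPts (hΩ : IsOpen Ω₁)
    (hP : ∀ γ ∈ pathsIn Ω₁, IsRealVec (endPt γ) → P (γ.1 0) → P (endPt γ)) :
    IsOpen {q : SliceCone n | ∃ γ : RealPath n, ∃ I ∈ unitsOf Ω₁ γ,
      psi I (endPt γ) = q ∧ P (γ.1 0)} := by
  intro J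
  rw [Metric.isOpen_iff]
  rintro z ⟨γ, I, hI, hz, h0⟩
  obtain ⟨δ, hJ, rfl, hδ0⟩ := exists_path_to_slice hP hI h0 hz.symm
  obtain ⟨r, hr, hb⟩ := Metric.isOpen_iff.1 (hΩ J) _ (hJ 1)
  refine ⟨r, hr, fun w hw => ?_⟩
  obtain ⟨β, hβ0, hβ1, hβ⟩ := δ.exists_segment w
  exact ⟨β, J, hβ J Ω₁ r hJ hb hw, by rw [hβ1], by rwa [hβ0]⟩

/-- A property of real points that is transported along paths in `Ω₁` between real points holds at
the starting point of every path in `Ω₁` or of none: the points of `Ω₁` reached from starting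
points with the property, and those reached from starting points without it, form two disjoint
slice-open sets. -/
theorem IsSliceDomain.forall_start (hΩ : IsSliceDomain Ω₁) (hr : IsRealPathConnected Ω₁)
    (hP : ∀ γ ∈ pathsIn Ω₁, IsRealVec (endPt γ) → P (γ.1 0) → P (endPt γ))
    {γ₀ : RealPath n} (hγ₀ : γ₀ ∈ pathsIn Ω₁) (h0 : P (γ₀.1 0)) :
    ∀ γ ∈ pathsIn Ω₁, P (γ.1 0) := by
  intro γ₁ hγ₁
  by_contra h1
  have hP' : ∀ γ ∈ pathsIn Ω₁, IsRealVec (endPt γ) → ¬ P (γ.1 0) → ¬ P (endPt γ) := by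
    rintro γ ⟨I, hI⟩ hre hn he
    obtain ⟨δ, hδ0, hδ1, hδ⟩ := γ.exists_reverse hre
    rw [← hδ0] at he
    rw [← hδ1] at hn
    refine hn (hP δ ⟨I, ?_⟩ (by rw [hδ1]; exact γ.isRealVec_zero) he)
    rw [unitsOf_eq, hδ, ← unitsOf_eq]
    exact hI
  obtain ⟨I₀, hI₀⟩ := hγ₀
  obtain ⟨I₁, hI₁⟩ := hγ₁
  obtain ⟨q, -, ⟨γ, I, hI, hq, hγ⟩, ⟨δ, J, hJ, hq', hδ⟩⟩ := hΩ.2 _ _ (isOpen_endPts hΩ.1 hP)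
    (isOpen_endPts (P := fun z => ¬ P z) hΩ.1 hP')
    (fun q hq => by
      obtain ⟨γ, -, I, hI, h⟩ := hr q hq
      by_cases hp : P (γ.1 0)
      · exact Or.inl ⟨γ, I, hI, h, hp⟩
      · exact Or.inr ⟨γ, I, hI, h, hp⟩)
    ⟨_, hI₀ 1, γ₀, I₀, hI₀, rfl, h0⟩ ⟨_, hI₁ 1, γ₁, I₁, hI₁, rfl, h1⟩
  obtain ⟨α, hα, hαe, hα0⟩ := exists_path_to_slice hP hI hγ (hq'.trans hq.symm)
  obtain ⟨ε, hε0, hε1, hε⟩ := α.exists_append_reverse δ hαe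
  refine hδ ?_
  rw [← hε1]
  refine hP ε ⟨J, ?_⟩ (by rw [hε1]; exact δ.isRealVec_zero) (by rwa [hε0])
  rw [hε]
  exact ⟨hα, hJ⟩

end Connected

theorem IsStemPreserving.pathsIn_subset (hS : IsStemPreserving Ω₁ Ω₂) :
    pathsIn Ω₁ ⊆ pathsIn Ω₂ := fun _ hγ => by
  obtain ⟨I, -, hI, -⟩ := hS.exists_units hγ
  exact ⟨I, hI⟩

/-! ### The zero set of the symmetrization -/

theorem IsSliceRegular.isPathSliceAnalytic_zeroSet (hΩ₁ : IsSliceDomain Ω₁)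
    (hΩ₁r : IsRealPathConnected Ω₁) (hΩ₂ : IsOpen Ω₂) (hS : IsStemPreserving Ω₁ Ω₂)
    (hf : IsSliceRegular Ω₂ f) (hF : IsStemFunction Ω₂ f (stemFun Ω₂ f)) :
    IsPathSliceAnalytic Ω₁ (zeroSet Ω₁ (symmetrization Ω₁ Ω₂ f)) := by
  refine ⟨fun q hq => hq.1, ?_⟩
  by_cases hv : ∃ γ ∈ pathsIn Ω₁, RealVanish f (γ.1 0)
  · left
    obtain ⟨γ₀, hγ₀, h0⟩ := hv
    refine Set.Subset.antisymm (fun q hq => hq.1) fun q hq => ⟨hq, ?_⟩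
    obtain ⟨γ, hγ, I, hI, rfl⟩ := hΩ₁r q hq
    have hγ0 : RealVanish f (γ.1 0) := hΩ₁.forall_start hΩ₁r
      (fun γ hγ _ h => h.endPt hΩ₂ hf (hS.pathsIn_subset hγ)) hγ₀ h0 γ hγ
    rw [symmetrization_eq_zero_iff hF hS hI, hγ0.stem_eq_zero hΩ₂ hf hS hF hγ]
    exact (complexNormSq_zero_right 0).2 rfl
  · right
    intro γ hγ
    obtain ⟨I, J, hI, hJ, hIJ⟩ := hS.exists_units hγ
    obtain ⟨r, hr, hb⟩ := Metric.isOpen_iff.1 ((hΩ₂ I).inter (hΩ₂ J)) (endPt γ) ⟨hI 1, hJ 1⟩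
    have hρ (K : ImUnit) : ∃ ρ : ℝ, K ∈ unitsOf Ω₁ γ →
        (0 < ρ ∧ ρ ≤ r) ∧ Metric.ball (endPt γ) ρ ⊆ sliceOf K Ω₁ := by
      by_cases hK : K ∈ unitsOf Ω₁ γ
      · obtain ⟨s, hs, hsb⟩ := Metric.isOpen_iff.1 (hΩ₁.1 K) (endPt γ) (hK 1)
        exact ⟨min s r, fun _ => ⟨⟨lt_min hs hr, min_le_right _ _⟩,
          (Metric.ball_subset_ball (min_le_left _ _)).trans hsb⟩⟩
      · exact ⟨0, fun h => (hK h).elim⟩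
    choose ρ hρ using hρ
    let N : Cn n → ℂ := fun z => complexNormSq (stemA f I J z) (stemB f I J z)
    have hN : DifferentiableOn ℂ N (Metric.ball (endPt γ) r) := fun z hz =>
      (hf.holStemAt hIJ (hb hz).1 (hb hz).2).differentiableAt_complexNormSq.differentiableWithinAt
    refine ⟨r, hr, ρ, fun K hK => (hρ K hK).1, {z | z ∈ Metric.ball (endPt γ) r ∧ N z = 0},
      ⟨fun z hz => hz.1, fun p hp => ⟨_, Metric.isOpen_ball, hp, subset_rfl, 1, fun _ => N,
        fun _ => hN, ?_⟩⟩, fun hE => ?_, ?_⟩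
    · ext z
      constructor
      · rintro ⟨⟨h1, h2⟩, -⟩
        exact ⟨h1, fun _ => h2⟩
      · rintro ⟨h1, h2⟩
        exact ⟨⟨h1, h2 0⟩, h1⟩
    · refine hv ⟨γ, hγ, hf.realVanish_of_complexNormSq hΩ₂ hI hJ hIJ ?_⟩
      filter_upwards [Metric.ball_mem_nhds (endPt γ) hr] with w hw
      rw [← hE] at hw
      exact hw.2
    · rintro K hK q ⟨⟨-, hq⟩, hqb⟩
      obtain ⟨⟨-, hρr⟩, hρb⟩ := hρ K hK
      rw [sliceBall_psi] at hqb
      obtain ⟨z, hz, rfl⟩ := hqb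
      have hzr := Metric.ball_subset_ball hρr hz
      -- `γ` prolonged by a segment to `z` stays in `Ω₁` in the slice of `K`, and in `Ω₂` in the
      -- slices of `I` and `J`, so its stem at `z` is the one that defines `N`.
      obtain ⟨β, -, rfl, hβ⟩ := γ.exists_segment z
      rw [symmetrization_eq_zero_iff hF hS (hβ K Ω₁ _ hK hρb hz),
        hF.eq_stem (hβ I Ω₂ r hI (hb.trans Set.inter_subset_left) hzr)
          (hβ J Ω₂ r hJ (hb.trans Set.inter_subset_right) hzr) hIJ] at hq
      exact ⟨_, ⟨hzr, hq⟩, rfl⟩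

end Vanishing

end SliceAnalysis

open SliceAnalysis
theorem mainTheorem2 {n : ℕ} (Ω₁ Ω₂ : Set (SliceCone n)) (f : SliceCone n → Quaternion ℝ)
    (hΩ₁ : IsSliceDomain Ω₁) (hΩ₁r : IsRealPathConnected Ω₁)
    (hΩ₂ : IsOpen Ω₂) (hΩ₂s : IsStemPreserving Ω₁ Ω₂)
    (hf : IsSliceRegular Ω₂ f) :
    IsPathSlice Ω₂ f ∧
      IsPathSliceAnalytic Ω₁ (zeroSet Ω₁ (symmetrization Ω₁ Ω₂ f)) := by
  have h : IsPathSlice Ω₂ f := hf.isPathSlice hΩ₂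
  refine ⟨h, hf.isPathSliceAnalytic_zeroSet hΩ₁ hΩ₁r hΩ₂ hΩ₂s ?_⟩
  rw [stemFun, dif_pos h]
  exact h.choose_spec
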